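/- Let $d\ge 1$, let $\Omega=\{1,\dots,d\}^{\mathbb N}$ with the product topology, let $\sigma:\Omega\to\Omega$, $\sigma(x_0x_1x_2\dots)=x_1x_2\dots$, be the shift, and let $\mathcal M_\sigma$ be the set of $\sigma$-invariant Borel probability measures on $\Omega$. Let $A:\Omega\to\mathbb R$ be continuous (for instance Hölder continuous). For $\beta\in\mathbb R$ put $$\mathbb{CP}(\beta A)=\sup_{\mu\in\mathcal M_\sigma}\Big\{h_\mu+\beta\int A\,d\mu\Big\},$$ where $h_\mu$ is the Kolmogorov entropy of $\sigma$ with respect to $\mu$. An equilibrium state for $\beta A$ is a measure $\mu\in\mathcal M_\sigma$ at which this supremum is attained. Then: 1. The maximum $m(A)=\max_{\nu\in\mathcal M_\sigma}\int A\,d\nu$ exists, $\mathbb{CP}(\beta A)$ is finite for every $\beta\in\mathbb R$, and the function $\beta\mapsto\mathbb{CP}(\beta A)$ has an asymptote of slope $m(A)$ as $\beta\to+\infty$: there is $c\in\mathbb R$ with $$\lim_{\beta\to+\infty}\big(\mathbb{CP}(\beta A)-\beta\, m(A)-c\big)=0.$$ 2. If for every $\beta>0$ a measure $\mu_\beta$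 is an equilibrium state for $\beta A$ (when $A$ is Hölder continuous, $\mu_\beta$ is the unique one), then every weak* accumulation point $\mu_\infty$ of $(\mu_\beta)$ as $\beta\to+\infty$ is $A$-maximizing, that is, $\mu_\infty\in\mathcal M_\sigma$ and $\int A\,d\mu_\infty=m(A)$. -/

import Mathlib

open MeasureTheory Filter Topology
open scoped ENNReal

noncomputable section

namespace ErgodicOpt

/-- The full shift space: one-sided infinite words over an alphabet with `d` letters. It carries
the product topology (the topology of the metric `2 ^ (-min {n | x n ≠ y n})`) and its Borel
sigma-algebra, which is the product sigma-algebra. -/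
abbrev Words (d : ℕ) : Type := ℕ → Fin d

/-- The shift map `(x₀, x₁, x₂, …) ↦ (x₁, x₂, …)`. -/
def shift {d : ℕ} (x : Words d) : Words d := fun n => x (n + 1)

/-- The set of shift-invariant Borel probability measures. -/
def invariantMeasures (d : ℕ) : Set (ProbabilityMeasure (Words d)) :=
  {μ | MeasurePreserving (shift (d := d)) (μ : Measure (Words d)) (μ : Measure (Words d))}

/-- The Shannon entropy `- ∑ μ(Pᵢ) log μ(Pᵢ)` of the finite partition into the fibres
`Pᵢ = f ⁻¹ {i}` of a map `f` with finitely many values. -/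
def partitionEntropy {α ι : Type*} [MeasurableSpace α] [Fintype ι] (μ : Measure α)
    (f : α → ι) : ℝ :=
  ∑ i, Real.negMulLog (μ.real (f ⁻¹' {i}))

/-- The labelling map of the refined partition `P ∨ T⁻¹P ∨ ⋯ ∨ T^{-(n-1)}P`, where `P` is the
partition into the fibres of `f`. -/
def itinerary {α : Type*} {k : ℕ} (T : α → α) (f : α → Fin k) (n : ℕ) (x : α) : Fin n → Fin k :=
  fun i => f (T^[i] x)

/-- The entropy of `T` relative to the partition into the fibres of `f`: the limit (it exists for
`T`-invariant `μ`) of `(1/n) H_μ(P ∨ T⁻¹P ∨ ⋯ ∨ T^{-(n-1)}P)`. -/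
def entropyRelPartition {α : Type*} [MeasurableSpace α] {k : ℕ} (T : α → α) (μ : Measure α)
    (f : α → Fin k) : ℝ≥0∞ :=
  limsup (fun n : ℕ => ENNReal.ofReal (partitionEntropy μ (itinerary T f n) / n)) atTop

/-- The Kolmogorov(-Sinai) entropy of `T` with respect to `μ`: the supremum over all finite
measurable partitions, a partition being given by a measurable labelling `f : α → Fin k`. -/
def kolmogorovEntropy {α : Type*} [MeasurableSpace α] (T : α → α) (μ : Measure α) : ℝ≥0∞ :=
  ⨆ (k : ℕ) (f : α → Fin k) (_ : Measurable f), entropyRelPartition T μ f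

/-- The free energy `h_μ + ∫ A dμ` of `μ` for the potential `A`. -/
def freeEnergy {d : ℕ} (A : Words d → ℝ) (μ : ProbabilityMeasure (Words d)) : EReal :=
  (kolmogorovEntropy (shift (d := d)) (μ : Measure (Words d)) : EReal) +
    ((∫ x, A x ∂(μ : Measure (Words d)) : ℝ) : EReal)

/-- The pressure of `A`: the supremum of the free energies of the invariant probabilities. -/
def pressure {d : ℕ} (A : Words d → ℝ) : EReal :=
  ⨆ μ ∈ invariantMeasures d, freeEnergy A μ

/-- An equilibrium state for `A`: an invariant probability that realizes the supremum
in the pressure. -/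
def IsEquilibriumState {d : ℕ} (A : Words d → ℝ) (μ : ProbabilityMeasure (Words d)) : Prop :=
  μ ∈ invariantMeasures d ∧ freeEnergy A μ = pressure A

/-- The set of values `∫ A dν`, `ν` an invariant probability. -/
def integralValues {d : ℕ} (A : Words d → ℝ) : Set ℝ :=
  (fun ν : ProbabilityMeasure (Words d) => ∫ x, A x ∂(ν : Measure (Words d))) ''
    invariantMeasures d

/-- An `A`-maximizing measure: an invariant probability whose integral of `A` is largest. -/
def IsMaximizing {d : ℕ} (A : Words d → ℝ) (μ : ProbabilityMeasure (Words d)) : Prop :=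
  μ ∈ invariantMeasures d ∧
    IsGreatest (integralValues A) (∫ x, A x ∂(μ : Measure (Words d)))

end ErgodicOpt

end

/-! Two facts carry the theorem: the invariant measures form a nonempty weak* compact set, and their
entropies all lie in `[0, log d]`. Compactness and continuity of the integral give `m`; the entropy
bound makes the pressure `P β` finite. Now `P β - m β` is the supremum of `h_μ - β (m - ∫ A dμ)`,
each term nonincreasing in `β`, and it is bounded below by the entropy of a maximizing measure.
Hence it converges (`exists_asymptote`). Comparing an equilibrium state with a maximizing measure
gives `∫ A dμ_β ≥ m - log d / β`, which passes to weak* limits.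

The laborious fact is `kolmogorovEntropy_shift_le`, since the entropy ranges over all measurable
partitions. A labelling `f` is approximated by a function of the first `N` letters. The first `n +
N` letters and the itinerary of a rarely nonzero error label then determine the `n`-itinerary of
`f`; the error label has small entropy, so the rate is at most `log d` plus an arbitrarily small
amount. -/

open Real in
/-- Subadditivity of `-x log x` on nonnegative numbers. -/
theorem negMulLog_sum_le {ι : Type*} (s : Finset ι) (x : ι → ℝ) (hx : ∀ i ∈ s, 0 ≤ x i) :
    negMulLog (∑ i ∈ s, x i) ≤ ∑ i ∈ s, negMulLog (x i) := by
  have h : negMulLog (∑ i ∈ s, x i) = ∑ i ∈ s, -x i * log (∑ j ∈ s, x j) := by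
    rw [negMulLog, ← Finset.sum_mul, Finset.sum_neg_distrib]
  rw [h]
  refine Finset.sum_le_sum fun i hi => ?_
  rcases (hx i hi).eq_or_lt with h0 | h0
  · simp [← h0]
  · have := log_le_log h0 (Finset.single_le_sum hx hi)
    rw [negMulLog]
    nlinarith

open Real in
/-- The pointwise Gibbs inequality. -/
theorem negMulLog_le_gibbs {p q : ℝ} (hp : 0 ≤ p) (hq : 0 ≤ q) (h : q = 0 → p = 0) :
    negMulLog p ≤ -p * log q + q - p := by
  rcases hp.eq_or_lt with rfl | hp'
  · simpa using hq
  · have hq' : 0 < q := hq.lt_of_ne fun h0 => hp'.ne' (h h0.symm)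
    have h1 := log_le_sub_one_of_pos (div_pos hq' hp')
    rw [log_div hq'.ne' hp'.ne'] at h1
    have h2 := mul_le_mul_of_nonneg_left h1 hp
    have h3 : p * (q / p - 1) = q - p := by field_simp
    rw [negMulLog]
    linarith

namespace ErgodicOpt

/-! ### Entropy of finite partitions -/

section Entropy

variable {α ι κ : Type*} [MeasurableSpace α] [Fintype ι] [MeasurableSpace ι]
  [MeasurableSingletonClass ι] [Fintype κ] [MeasurableSpace κ] [MeasurableSingletonClass κ]

theorem sum_measureReal_fibre (μ : Measure α) [IsProbabilityMeasure μ] {f : α → ι}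
    (hf : Measurable f) : ∑ i, μ.real (f ⁻¹' {i}) = 1 := by
  rw [sum_measureReal_preimage_singleton _ fun i _ => hf (measurableSet_singleton i)]
  simp

theorem partitionEntropy_comp_le {ω : Type*} [Fintype ω] (μ : Measure α)
    [IsProbabilityMeasure μ] {f : α → ι} (hf : Measurable f) (φ : ι → ω) :
    partitionEntropy μ (φ ∘ f) ≤ partitionEntropy μ f := by
  classical
  unfold partitionEntropy
  rw [← Finset.sum_fiberwise (s := Finset.univ) (g := φ)]
  refine Finset.sum_le_sum fun j _ => ?_
  have h : μ.real ((φ ∘ f) ⁻¹' {j}) = ∑ i with φ i = j, μ.real (f ⁻¹' {i}) := by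
    rw [sum_measureReal_preimage_singleton _ fun i _ => hf (measurableSet_singleton i)]
    congr 1
    ext x
    simp
  rw [h]
  exact negMulLog_sum_le _ _ fun _ _ => measureReal_nonneg

/-- Gibbs' inequality for the joint law against the product of its marginals; both have mass 1, so
the linear terms cancel. -/
theorem partitionEntropy_prodMk_le (μ : Measure α) [IsProbabilityMeasure μ] {f : α → ι}
    {g : α → κ} (hf : Measurable f) (hg : Measurable g) :
    partitionEntropy μ (fun x => (f x, g x)) ≤ partitionEntropy μ f + partitionEntropy μ g := by
  classical
  have hfg : Measurable fun x => (f x, g x) := hf.prodMk hg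
  set p : ι → κ → ℝ := fun i j => μ.real ((fun x => (f x, g x)) ⁻¹' {(i, j)}) with hp
  set a : ι → ℝ := fun i => μ.real (f ⁻¹' {i}) with ha
  set b : κ → ℝ := fun j => μ.real (g ⁻¹' {j}) with hb
  have hpa (i : ι) : ∑ j, p i j = a i := by
    have h := sum_measureReal_preimage_singleton (μ := μ) (f := fun x => (f x, g x))
      (({i} : Finset ι) ×ˢ (Finset.univ : Finset κ))
      fun y _ => hfg (measurableSet_singleton y)
    rw [Finset.sum_product, Finset.sum_singleton] at h
    rw [hp, ha]
    refine h.trans (congrArg μ.real ?_)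
    ext x
    simp [eq_comm]
  have hpb (j : κ) : ∑ i, p i j = b j := by
    have h := sum_measureReal_preimage_singleton (μ := μ) (f := fun x => (f x, g x))
      ((Finset.univ : Finset ι) ×ˢ ({j} : Finset κ))
      fun y _ => hfg (measurableSet_singleton y)
    rw [Finset.sum_product_right, Finset.sum_singleton] at h
    rw [hp, hb]
    refine h.trans (congrArg μ.real ?_)
    ext x
    simp [eq_comm]
  have hp0 (i : ι) (j : κ) : 0 ≤ p i j := measureReal_nonneg
  have key (i : ι) (j : κ) : Real.negMulLog (p i j) ≤
      p i j * -Real.log (a i) + p i j * -Real.log (b j) + a i * b j - p i j := by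
    have hpa' : p i j ≤ a i :=
      (hpa i) ▸ Finset.single_le_sum (fun j _ => hp0 i j) (Finset.mem_univ j)
    have hpb' : p i j ≤ b j :=
      (hpb j) ▸ Finset.single_le_sum (fun i _ => hp0 i j) (Finset.mem_univ i)
    have ha0 := (hp0 i j).trans hpa'
    have hb0 := (hp0 i j).trans hpb'
    -- If the joint mass vanishes a marginal may vanish too, and the logarithm of the product need
    -- not split.
    rcases (hp0 i j).eq_or_lt with h0 | h0
    · rw [← h0]
      simpa using mul_nonneg ha0 hb0
    · have ha1 := h0.trans_le hpa'
      have hb1 := h0.trans_le hpb'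
      refine (negMulLog_le_gibbs h0.le (mul_nonneg ha0 hb0)
        fun h => absurd h (mul_pos ha1 hb1).ne').trans (le_of_eq ?_)
      rw [Real.log_mul ha1.ne' hb1.ne']
      ring
  have hA : ∑ i, a i = 1 := sum_measureReal_fibre μ hf
  have hB : ∑ j, b j = 1 := sum_measureReal_fibre μ hg
  have h1 : ∑ i, ∑ j, p i j * -Real.log (a i) = partitionEntropy μ f := by
    simp_rw [← Finset.sum_mul, hpa]
    exact Finset.sum_congr rfl fun i _ => by rw [Real.negMulLog]; ring
  have h2 : ∑ i, ∑ j, p i j * -Real.log (b j) = partitionEntropy μ g := by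
    rw [Finset.sum_comm]
    simp_rw [← Finset.sum_mul, hpb]
    exact Finset.sum_congr rfl fun i _ => by rw [Real.negMulLog]; ring
  have h3 : ∑ i, ∑ j, a i * b j = 1 := by
    rw [← Finset.sum_mul_sum, hA, hB, one_mul]
  have h4 : ∑ i, ∑ j, p i j = 1 := by simp_rw [hpa]; exact hA
  calc partitionEntropy μ (fun x => (f x, g x)) = ∑ i, ∑ j, Real.negMulLog (p i j) := by
        rw [partitionEntropy, Fintype.sum_prod_type]
    _ ≤ ∑ i, ∑ j, (p i j * -Real.log (a i) + p i j * -Real.log (b j) + a i * b j - p i j) :=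
        Finset.sum_le_sum fun i _ => Finset.sum_le_sum fun j _ => key i j
    _ = partitionEntropy μ f + partitionEntropy μ g := by
        simp_rw [Finset.sum_sub_distrib, Finset.sum_add_distrib]
        rw [h1, h2, h3, h4]
        ring

/-- Gibbs' inequality against the uniform law. -/
theorem partitionEntropy_le_log_card (μ : Measure α) [IsProbabilityMeasure μ] {f : α → ι}
    (hf : Measurable f) : partitionEntropy μ f ≤ Real.log (Fintype.card ι) := by
  have hs := sum_measureReal_fibre μ hf
  have hne : Nonempty ι := by
    by_contra h
    rw [not_nonempty_iff] at h
    simp at hs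
  have hN : (0 : ℝ) < Fintype.card ι := by exact_mod_cast Fintype.card_pos
  calc partitionEntropy μ f
      ≤ ∑ i, (-μ.real (f ⁻¹' {i}) * Real.log (Fintype.card ι : ℝ)⁻¹ + (Fintype.card ι : ℝ)⁻¹ -
          μ.real (f ⁻¹' {i})) :=
        Finset.sum_le_sum fun i _ => negMulLog_le_gibbs measureReal_nonneg (inv_pos.2 hN).le
          fun h => absurd h (inv_pos.2 hN).ne'
    _ = Real.log (Fintype.card ι) := by
        rw [Finset.sum_sub_distrib, Finset.sum_add_distrib, ← Finset.sum_mul,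
          Finset.sum_neg_distrib, hs, Finset.sum_const, Finset.card_univ, nsmul_eq_mul,
          mul_inv_cancel₀ hN.ne', Real.log_inv]
        ring

theorem partitionEntropy_comp_measurePreserving {μ : Measure α} {T : α → α}
    (hT : MeasurePreserving T μ μ) {f : α → ι} (hf : Measurable f) :
    partitionEntropy μ (f ∘ T) = partitionEntropy μ f := by
  refine Finset.sum_congr rfl fun i _ => ?_
  rw [Set.preimage_comp,
    hT.measureReal_preimage (hf (measurableSet_singleton i)).nullMeasurableSet]

theorem measurable_itinerary {T : α → α} (hT : Measurable T) {k : ℕ} {f : α → Fin k}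
    (hf : Measurable f) (n : ℕ) : Measurable (itinerary T f n) :=
  measurable_pi_lambda _ fun i => hf.comp (hT.iterate i)

theorem partitionEntropy_itinerary_le {μ : Measure α} [IsProbabilityMeasure μ] {T : α → α}
    (hT : MeasurePreserving T μ μ) {k : ℕ} {f : α → Fin k} (hf : Measurable f) (n : ℕ) :
    partitionEntropy μ (itinerary T f n) ≤ n * partitionEntropy μ f := by
  induction n with
  | zero => simpa using partitionEntropy_le_log_card μ (measurable_itinerary hT.measurable hf 0)
  | succ n ih =>
    have hn := measurable_itinerary hT.measurable hf n
    have hfn : Measurable (f ∘ T^[n]) := hf.comp (hT.measurable.iterate n)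
    have h : itinerary T f (n + 1) =
        (fun p : (Fin n → Fin k) × Fin k => (Fin.snoc p.1 p.2 : Fin (n + 1) → Fin k)) ∘
          fun x => (itinerary T f n x, (f ∘ T^[n]) x) := by
      ext x i
      refine Fin.lastCases ?_ (fun j => ?_) i
      · simp [itinerary]
      · simp [itinerary]
    calc partitionEntropy μ (itinerary T f (n + 1))
        ≤ partitionEntropy μ fun x => (itinerary T f n x, (f ∘ T^[n]) x) := by
          rw [h]
          exact partitionEntropy_comp_le μ (hn.prodMk hfn) _
      _ ≤ partitionEntropy μ (itinerary T f n) + partitionEntropy μ (f ∘ T^[n]) :=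
          partitionEntropy_prodMk_le μ hn hfn
      _ ≤ (n + 1 : ℕ) * partitionEntropy μ f := by
          rw [partitionEntropy_comp_measurePreserving (hT.iterate n) hf]
          push_cast
          linarith

/-- A partition with one atom of nearly full measure has small entropy. -/
theorem exists_partitionEntropy_le (k : ℕ) {η : ℝ} (hη : 0 < η) :
    ∃ δ > 0, ∀ (μ : Measure α) [IsProbabilityMeasure μ] (e : α → Fin (k + 1)), Measurable e →
      μ.real (e ⁻¹' {0})ᶜ ≤ δ → partitionEntropy μ e ≤ η := by
  -- Half of `η` is for the large atom, the other half is shared by the `k` small ones.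
  have hη' : 0 < η / (2 * (k + 1)) := by positivity
  obtain ⟨δ, hδ, h⟩ := Metric.continuousAt_iff.1
    (Real.continuous_negMulLog.continuousAt (x := 0)) _ hη'
  refine ⟨min (η / 2) (δ / 2), by positivity, fun μ _ e he hμ => ?_⟩
  have hδ2 : μ.real (e ⁻¹' {0})ᶜ < δ := by
    have := hμ.trans (min_le_right _ _)
    linarith
  have h0 : Real.negMulLog (μ.real (e ⁻¹' {0})) ≤ η / 2 := by
    refine (Real.negMulLog_le_one_sub_self measureReal_nonneg).trans ?_
    rw [← probReal_compl_eq_one_sub (he (measurableSet_singleton 0))]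
    exact hμ.trans (min_le_left _ _)
  have hi (i : Fin k) : Real.negMulLog (μ.real (e ⁻¹' {i.succ})) ≤ η / (2 * (k + 1)) := by
    have hle : μ.real (e ⁻¹' {i.succ}) ≤ μ.real (e ⁻¹' {0})ᶜ := by
      refine measureReal_mono fun x hx => ?_
      simp only [Set.mem_preimage, Set.mem_singleton_iff] at hx
      simp [hx]
    have := @h (μ.real (e ⁻¹' {i.succ})) (by
      rw [Real.dist_eq, sub_zero, abs_of_nonneg measureReal_nonneg]
      exact hle.trans_lt hδ2)
    rw [Real.negMulLog_zero, Real.dist_eq, sub_zero] at this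
    exact (le_abs_self _).trans this.le
  calc partitionEntropy μ e ≤ η / 2 + ∑ _i : Fin k, η / (2 * (k + 1)) := by
        rw [partitionEntropy, Fin.sum_univ_succ]
        exact add_le_add h0 (Finset.sum_le_sum fun i _ => hi i)
    _ ≤ η := by
        rw [Finset.sum_const, Finset.card_univ, Fintype.card_fin, nsmul_eq_mul]
        have : (k : ℝ) * (η / (2 * (k + 1))) ≤ η / 2 := by
          rw [mul_div_assoc', div_le_div_iff₀ (by positivity) (by positivity)]
          nlinarith
        linarith

end Entropy

/-! ### Entropy of the full shift -/

section Shift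

variable {d : ℕ}

theorem continuous_shift : Continuous (shift (d := d)) :=
  continuous_pi fun n => continuous_apply (n + 1)

theorem iterate_shift_apply (i l : ℕ) (x : Words d) : shift^[i] x l = x (i + l) := by
  induction i generalizing x with
  | zero => simp
  | succ i ih => rw [Function.iterate_succ_apply, ih, shift, add_right_comm]

/-- A measurable labelling is close in measure to one that depends on finitely many letters. -/
theorem exists_prefix_labelling (hd : 1 ≤ d) (μ : Measure (Words d)) [IsProbabilityMeasure μ]
    {k : ℕ} {f : Words d → Fin k} (hf : Measurable f) {δ : ℝ} (hδ : 0 < δ) :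
    ∃ (N : ℕ) (G : (Fin N → Fin d) → Fin k),
      μ.real {x | f x ≠ G fun i => x i} ≤ δ := by
  classical
  have hk : 0 < k := (f fun _ => ⟨0, hd⟩).pos
  have hδk : 0 < δ / k := by positivity
  have hC (j : Fin k) : ∃ C ∈ measurableCylinders (fun _ : ℕ => Fin d),
      μ (symmDiff C (f ⁻¹' {j})) < ENNReal.ofReal (δ / k) :=
    exists_measure_symmDiff_lt_of_generateFrom_isSetRing isSetRing_measurableCylinders
      ⟨{Set.univ}, Set.countable_singleton _,
        Set.singleton_subset_iff.2 (univ_mem_measurableCylinders _), by simp⟩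
      generateFrom_measurableCylinders.symm (hf (measurableSet_singleton j))
      (ENNReal.ofReal_pos.2 hδk)
  choose C hCmem hCμ using hC
  choose s S _ hCS using fun j => (mem_measurableCylinders _).1 (hCmem j)
  obtain ⟨N, hN⟩ := (Finset.univ.biUnion s).exists_nat_subset_range
  have hinv (j : Fin k) (x y : Words d) (hxy : ∀ i < N, x i = y i) : x ∈ C j ↔ y ∈ C j := by
    rw [hCS j, mem_cylinder, mem_cylinder]
    have : (s j).restrict x = (s j).restrict y := by
      ext i
      have hi : (i : ℕ) ∈ Finset.range N :=
        hN (Finset.mem_biUnion.2 ⟨j, Finset.mem_univ j, i.2⟩)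
      exact congrArg Fin.val (hxy i (Finset.mem_range.1 hi))
    rw [this]
  -- The padding is immaterial: by `hinv` the sets `C j` see only the first `N` letters.
  let ext (v : Fin N → Fin d) : Words d := fun n => if h : n < N then v ⟨n, h⟩ else ⟨0, hd⟩
  let G (v : Fin N → Fin d) : Fin k := if h : ∃ j, ext v ∈ C j then h.choose else ⟨0, hk⟩
  refine ⟨N, G, ?_⟩
  have hsub : {x | f x ≠ G fun i => x i} ⊆ ⋃ j, symmDiff (C j) (f ⁻¹' {j}) := by
    intro x hx
    by_contra hnot
    apply hx
    have hmem (j : Fin k) : x ∈ C j ↔ f x = j := by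
      simp only [Set.mem_iUnion, not_exists, Set.mem_symmDiff, Set.mem_preimage,
        Set.mem_singleton_iff] at hnot
      have := hnot j
      tauto
    have hext (j : Fin k) : (ext fun i => x i) ∈ C j ↔ f x = j := by
      rw [← hmem j]
      exact hinv j _ _ fun i hi => by simp [ext, hi]
    have hex : ∃ j, (ext fun i => x i) ∈ C j := ⟨f x, (hext _).2 rfl⟩
    simp only [G, dif_pos hex]
    exact (hext _).1 hex.choose_spec
  calc μ.real {x | f x ≠ G fun i => x i}
      ≤ μ.real (⋃ j, symmDiff (C j) (f ⁻¹' {j})) := measureReal_mono hsub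
    _ ≤ ∑ j, μ.real (symmDiff (C j) (f ⁻¹' {j})) := measureReal_iUnion_fintype_le _
    _ ≤ ∑ _j : Fin k, δ / k := Finset.sum_le_sum fun j _ =>
        ENNReal.toReal_le_of_le_ofReal hδk.le (hCμ j).le
    _ = δ := by
        rw [Finset.sum_const, Finset.card_univ, Fintype.card_fin, nsmul_eq_mul]
        have : (k : ℝ) ≠ 0 := by positivity
        field_simp

theorem partitionEntropy_itinerary_shift_le (hd : 1 ≤ d) {μ : Measure (Words d)}
    [IsProbabilityMeasure μ] (hμ : MeasurePreserving (shift (d := d)) μ μ) {k : ℕ}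
    {f : Words d → Fin k} (hf : Measurable f) {η : ℝ} (hη : 0 < η) :
    ∃ N : ℕ, ∀ n : ℕ,
      partitionEntropy μ (itinerary shift f n) ≤ (n + N) * Real.log d + n * η := by
  obtain ⟨δ, hδ, hent⟩ := exists_partitionEntropy_le (α := Words d) k hη
  obtain ⟨N, G, hG⟩ := exists_prefix_labelling hd μ hf hδ
  let g : Words d → Fin k := fun x => G fun i => x i
  -- The error label: 0 where the approximation is right, otherwise the true label shifted by one.
  let e : Words d → Fin (k + 1) := fun x => if f x = g x then 0 else (f x).succ
  have hg : Measurable g := (measurable_of_finite G).comp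
    (measurable_pi_lambda _ fun i => measurable_pi_apply _)
  have he : Measurable e := Measurable.ite (measurableSet_eq_fun hf hg) measurable_const
    ((measurable_of_finite Fin.succ).comp hf)
  have heη : partitionEntropy μ e ≤ η := by
    refine hent μ e he ((measureReal_mono fun x hx => ?_).trans hG)
    intro hfx
    apply hx
    simp only [Set.mem_preimage, Set.mem_singleton_iff, e, g]
    exact if_pos hfx
  refine ⟨N, fun n => ?_⟩
  let w : Words d → Fin (n + N) → Fin d := fun x i => x i
  have hw : Measurable w := measurable_pi_lambda _ fun i => measurable_pi_apply _
  have hen := measurable_itinerary hμ.measurable he n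
  -- The decoder: on error 0 it applies `G` to the window of `N` letters starting at `i`, otherwise
  -- it reads the label off the error.
  let Φ : (Fin (n + N) → Fin d) × (Fin n → Fin (k + 1)) → Fin n → Fin k := fun p i =>
    Fin.cases (motive := fun _ => Fin k)
      (G fun l => p.1 ⟨i + l, by omega⟩) (fun j => j) (p.2 i)
  have hΦ : itinerary shift f n = Φ ∘ fun x => (w x, itinerary shift e n x) := by
    funext x i
    have hgx : g (shift^[i] x) = G fun l => x (i + l) :=
      congrArg G (funext fun l => iterate_shift_apply i l x)
    by_cases h : f (shift^[i] x) = g (shift^[i] x)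
    · simp only [itinerary, Φ, Function.comp, e, if_pos h, w, Fin.cases_zero]
      rw [h, hgx]
    · simp only [itinerary, Φ, Function.comp, e, if_neg h, Fin.cases_succ]
  calc partitionEntropy μ (itinerary shift f n)
      ≤ partitionEntropy μ fun x => (w x, itinerary shift e n x) := by
        rw [hΦ]
        exact partitionEntropy_comp_le μ (hw.prodMk hen) Φ
    _ ≤ partitionEntropy μ w + partitionEntropy μ (itinerary shift e n) :=
        partitionEntropy_prodMk_le μ hw hen
    _ ≤ (n + N) * Real.log d + n * η := by
        refine add_le_add ((partitionEntropy_le_log_card μ hw).trans (le_of_eq ?_))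
          ((partitionEntropy_itinerary_le hμ he n).trans (by gcongr))
        simp

/-- The entropy of the full shift on `d` letters is at most `log d`. -/
theorem kolmogorovEntropy_shift_le (hd : 1 ≤ d) {μ : Measure (Words d)}
    [IsProbabilityMeasure μ] (hμ : MeasurePreserving (shift (d := d)) μ μ) :
    kolmogorovEntropy (shift (d := d)) μ ≤ ENNReal.ofReal (Real.log d) := by
  refine iSup_le fun k => iSup_le fun f => iSup_le fun hf => ?_
  refine ENNReal.le_of_forall_pos_le_add fun η hη _ => ?_
  obtain ⟨N, hN⟩ := partitionEntropy_itinerary_shift_le hd hμ hf (η := η) hη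
  have hlim : Tendsto (fun n : ℕ => Real.log d + N * Real.log d / n + η) atTop
      (𝓝 (Real.log d + 0 + η)) :=
    (tendsto_const_nhds.add (tendsto_const_div_atTop_nhds_zero_nat _)).add tendsto_const_nhds
  rw [add_zero] at hlim
  rw [← ENNReal.ofReal_coe_nnreal,
    ← ENNReal.ofReal_add (Real.log_natCast_nonneg d) η.coe_nonneg,
    ← (ENNReal.tendsto_ofReal hlim).limsup_eq]
  refine limsup_le_limsup ?_
  filter_upwards [eventually_gt_atTop 0] with n hn
  refine ENNReal.ofReal_le_ofReal ?_
  have hn' : (0 : ℝ) < n := by exact_mod_cast hn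
  rw [div_le_iff₀ hn']
  refine (hN n).trans (le_of_eq ?_)
  field_simp

/-! ### Compactness of the invariant measures and finiteness of the pressure -/

theorem continuous_integral {A : Words d → ℝ} (hA : Continuous A) :
    Continuous fun μ : ProbabilityMeasure (Words d) => ∫ x, A x ∂(μ : Measure (Words d)) :=
  ProbabilityMeasure.continuous_integral_continuousMap (⟨A, hA⟩ : C(Words d, ℝ))

theorem isClosed_invariantMeasures : IsClosed (invariantMeasures d) := by
  have h : invariantMeasures d =
      {μ | μ.map (continuous_shift (d := d)).measurable.aemeasurable = μ} := by
    ext μ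
    simp only [invariantMeasures, Set.mem_ofPred_eq]
    refine ⟨fun hμ => Subtype.ext hμ.map_eq, fun hμ => ⟨continuous_shift.measurable, ?_⟩⟩
    exact congrArg Subtype.val hμ
  rw [h]
  exact isClosed_eq (ProbabilityMeasure.continuous_map continuous_shift) continuous_id

theorem invariantMeasures_nonempty (hd : 1 ≤ d) : (invariantMeasures d).Nonempty := by
  let x : Words d := fun _ => ⟨0, hd⟩
  refine ⟨⟨Measure.dirac x, inferInstance⟩, continuous_shift.measurable, ?_⟩
  exact Measure.map_dirac' continuous_shift.measurable x

theorem exists_isGreatest_integralValues (hd : 1 ≤ d) {A : Words d → ℝ} (hA : Continuous A) :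
    ∃ m, IsGreatest (integralValues A) m :=
  (isClosed_invariantMeasures.isCompact.image (continuous_integral hA)).exists_isGreatest
    ((invariantMeasures_nonempty hd).image _)

theorem freeEnergy_eq_coe (hd : 1 ≤ d) (A : Words d → ℝ) {μ : ProbabilityMeasure (Words d)}
    (hμ : μ ∈ invariantMeasures d) :
    freeEnergy A μ =
      (((kolmogorovEntropy (shift (d := d)) (μ : Measure (Words d))).toReal +
        ∫ x, A x ∂(μ : Measure (Words d)) : ℝ) : EReal) := by
  have hfin : kolmogorovEntropy (shift (d := d)) (μ : Measure (Words d)) ≠ ⊤ :=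
    ((kolmogorovEntropy_shift_le hd hμ).trans_lt ENNReal.ofReal_lt_top).ne
  rw [freeEnergy, EReal.coe_add, ← EReal.toReal_coe_ennreal, EReal.coe_toReal (by simpa using hfin) (by simp)]

theorem toReal_kolmogorovEntropy_shift_le (hd : 1 ≤ d) {μ : ProbabilityMeasure (Words d)}
    (hμ : μ ∈ invariantMeasures d) :
    (kolmogorovEntropy (shift (d := d)) (μ : Measure (Words d))).toReal ≤ Real.log d :=
  ENNReal.toReal_le_of_le_ofReal (Real.log_natCast_nonneg d) (kolmogorovEntropy_shift_le hd hμ)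

/-- Transfers the `EReal` supremum to a real least upper bound, to which `exists_asymptote` applies.
-/
theorem pressure_eq_coe (hd : 1 ≤ d) {A : Words d → ℝ} {p : ℝ}
    (hp : IsLUB ((fun μ : ProbabilityMeasure (Words d) =>
      (kolmogorovEntropy (shift (d := d)) (μ : Measure (Words d))).toReal +
        ∫ x, A x ∂(μ : Measure (Words d))) '' invariantMeasures d) p) :
    pressure A = (p : EReal) := by
  have hle : pressure A ≤ (p : EReal) := iSup₂_le fun μ hμ => by
    rw [freeEnergy_eq_coe hd A hμ]
    exact EReal.coe_le_coe_iff.2 (hp.1 (Set.mem_image_of_mem _ hμ))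
  have hge {μ : ProbabilityMeasure (Words d)} (hμ : μ ∈ invariantMeasures d) :
      freeEnergy A μ ≤ pressure A := le_iSup₂ (f := fun μ _ => freeEnergy A μ) μ hμ
  have htop : pressure A ≠ ⊤ := (hle.trans_lt (EReal.coe_lt_top p)).ne
  have hbot : pressure A ≠ ⊥ := by
    obtain ⟨μ, hμ⟩ := invariantMeasures_nonempty hd
    have := hge hμ
    rw [freeEnergy_eq_coe hd A hμ] at this
    exact ((EReal.bot_lt_coe _).trans_le this).ne'
  refine hle.antisymm ?_
  rw [← EReal.coe_toReal htop hbot, EReal.coe_le_coe_iff]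
  refine hp.2 ?_
  rintro _ ⟨μ, hμ, rfl⟩
  have := hge hμ
  rwa [freeEnergy_eq_coe hd A hμ, ← EReal.coe_toReal htop hbot, EReal.coe_le_coe_iff] at this

theorem exists_isLUB_freeEnergy (hd : 1 ≤ d) {A : Words d → ℝ} (hA : Continuous A) :
    ∃ p, IsLUB ((fun μ : ProbabilityMeasure (Words d) =>
      (kolmogorovEntropy (shift (d := d)) (μ : Measure (Words d))).toReal +
        ∫ x, A x ∂(μ : Measure (Words d))) '' invariantMeasures d) p := by
  obtain ⟨m, _, hm⟩ := exists_isGreatest_integralValues hd hA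
  refine Real.exists_isLUB ((invariantMeasures_nonempty hd).image _) ⟨Real.log d + m, ?_⟩
  rintro _ ⟨μ, hμ, rfl⟩
  exact add_le_add (toReal_kolmogorovEntropy_shift_le hd hμ) (hm (Set.mem_image_of_mem _ hμ))

end Shift

/-! ### The limit `β → ∞` -/

/-- Let `v` have the maximum `m` on `s` and let `h` be nonnegative on `s`. Then the supremum over
`s` of `h + β v` has an asymptote of slope `m` as `β → ∞`. -/
theorem exists_asymptote {X : Type*} {s : Set X} {h v : X → ℝ} {m : ℝ} {P : ℝ → ℝ}
    (hh : ∀ x ∈ s, 0 ≤ h x) (hm : IsGreatest (v '' s) m)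
    (hP : ∀ β : ℝ, IsLUB ((fun x => h x + β * v x) '' s) (P β)) :
    ∃ c : ℝ, Tendsto (fun β : ℝ => P β - (m * β + c)) atTop (𝓝 0) := by
  obtain ⟨⟨x₀, hx₀, rfl⟩, hmax⟩ := hm
  have hanti : Antitone fun β => P β - v x₀ * β := by
    intro β γ hβγ
    change P γ - v x₀ * γ ≤ P β - v x₀ * β
    rw [sub_le_iff_le_add]
    refine (hP γ).2 ?_
    rintro _ ⟨x, hx, rfl⟩
    have h1 : h x + β * v x ≤ P β := (hP β).1 (Set.mem_image_of_mem _ hx)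
    have h2 : v x ≤ v x₀ := hmax (Set.mem_image_of_mem _ hx)
    change h x + γ * v x ≤ _
    nlinarith
  have hbdd : BddBelow (Set.range fun β => P β - v x₀ * β) := by
    refine ⟨0, ?_⟩
    rintro _ ⟨β, rfl⟩
    have h1 : h x₀ + β * v x₀ ≤ P β := (hP β).1 (Set.mem_image_of_mem _ hx₀)
    have h2 := hh x₀ hx₀
    change 0 ≤ P β - v x₀ * β
    linarith
  refine ⟨⨅ β, (P β - v x₀ * β), ?_⟩
  have := (tendsto_atTop_ciInf hanti hbdd).sub_const (⨅ β, (P β - v x₀ * β))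
  rw [sub_self] at this
  exact this.congr fun β => by ring

/-- The integral over an equilibrium state for `β A` is within `log d / β` of the maximum. -/
theorem le_integral_of_isEquilibriumState {d : ℕ} (hd : 1 ≤ d) {A : Words d → ℝ} {m : ℝ}
    (hm : m ∈ integralValues A) {β : ℝ} (hβ : 0 < β) {μ : ProbabilityMeasure (Words d)}
    (hμ : IsEquilibriumState (fun x => β * A x) μ) :
    m - Real.log d / β ≤ ∫ x, A x ∂(μ : Measure (Words d)) := by
  obtain ⟨ν, hν, rfl⟩ := hm
  have h : freeEnergy (fun x => β * A x) ν ≤ freeEnergy (fun x => β * A x) μ :=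
    hμ.2 ▸ le_iSup₂ (f := fun μ _ => freeEnergy (fun x => β * A x) μ) ν hν
  rw [freeEnergy_eq_coe hd _ hν, freeEnergy_eq_coe hd _ hμ.1, EReal.coe_le_coe_iff,
    integral_const_mul, integral_const_mul] at h
  have h1 := toReal_kolmogorovEntropy_shift_le hd hμ.1
  have h2 : 0 ≤ (kolmogorovEntropy (shift (d := d)) (ν : Measure (Words d))).toReal :=
    ENNReal.toReal_nonneg
  rw [sub_le_iff_le_add, ← mul_le_mul_iff_right₀ hβ, mul_add, mul_div_cancel₀ _ hβ.ne']
  linarith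

end ErgodicOpt

theorem mainTheorem5 (d : ℕ) (hd : 1 ≤ d) (A : ErgodicOpt.Words d → ℝ) (hA : Continuous A) :
    -- the maximum `m = m(A)` exists, and the pressure is finite with an asymptote of slope `m`
    (∃ m : ℝ, IsGreatest (ErgodicOpt.integralValues A) m ∧
      ∃ P : ℝ → ℝ, (∀ β : ℝ, ErgodicOpt.pressure (fun x => β * A x) = (P β : EReal)) ∧
        ∃ c : ℝ, Tendsto (fun β : ℝ => P β - (m * β + c)) atTop (𝓝 0)) ∧
    -- weak* accumulation points of equilibrium states are maximizing
    (∀ μ : ℝ → ProbabilityMeasure (ErgodicOpt.Words d),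
      (∀ β : ℝ, 0 < β → ErgodicOpt.IsEquilibriumState (fun x => β * A x) (μ β)) →
      ∀ μ_lim : ProbabilityMeasure (ErgodicOpt.Words d),
        MapClusterPt μ_lim atTop μ → ErgodicOpt.IsMaximizing A μ_lim) := by
  obtain ⟨m, hm⟩ := ErgodicOpt.exists_isGreatest_integralValues hd hA
  refine ⟨⟨m, hm, ?_⟩, fun μ hμ μ_lim hlim => ?_⟩
  · choose P hP using fun β : ℝ =>
      ErgodicOpt.exists_isLUB_freeEnergy hd (hA.const_mul β)
    refine ⟨P, fun β => ErgodicOpt.pressure_eq_coe hd (hP β), ?_⟩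
    simp only [integral_const_mul] at hP
    exact ErgodicOpt.exists_asymptote (fun _ _ => ENNReal.toReal_nonneg) hm hP
  -- Along an ultrafilter finer than `atTop` the accumulation point becomes a limit.
  · obtain ⟨U, hU, hUlim⟩ := mapClusterPt_iff_ultrafilter.1 hlim
    have hpos : ∀ᶠ β : ℝ in U, 0 < β := hU (eventually_gt_atTop 0)
    have hinv : μ_lim ∈ ErgodicOpt.invariantMeasures d :=
      ErgodicOpt.isClosed_invariantMeasures.mem_of_tendsto hUlim
        (hpos.mono fun β hβ => (hμ β hβ).1)
    have hint := ((ErgodicOpt.continuous_integral hA).tendsto μ_lim).comp hUlim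
    have hlow : Tendsto (fun β : ℝ => m - Real.log d / β) U (𝓝 m) := by
      have h : Tendsto (fun β : ℝ => m - Real.log d / β) atTop (𝓝 (m - 0)) :=
        tendsto_const_nhds.sub (tendsto_const_nhds.div_atTop tendsto_id)
      rw [sub_zero] at h
      exact h.mono_left hU
    have hge := le_of_tendsto_of_tendsto hlow hint (hpos.mono fun β hβ =>
      ErgodicOpt.le_integral_of_isEquilibriumState hd hm.1 hβ (hμ β hβ))
    exact ⟨hinv, Set.mem_image_of_mem _ hinv, fun y hy => (hm.2 hy).trans hge⟩
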